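/- Let $(\Omega,\mathcal F,\mathsf P)$ be a complete probability space carrying a one-dimensional standard Brownian motion $B=(B_t)_{t\ge 0}$, and let $\mathbb F=(\mathcal F_t)_{t\ge0}$ be the filtration generated by $B$ and augmented by the $\mathsf P$-null sets. Let $\lambda,\theta,\mu,\sigma>0$, and for $x\in\mathbb R$ let $X^x$ be the Ornstein–Uhlenbeck process solving $dX^x_t=\theta(\mu-X^x_t)\,dt+\sigma\,dB_t$, $X^x_0=x$. Let $\Phi\in C^2(\mathbb R)$ be real-valued, decreasing and strictly convex on $[0,1]$, with $\Phi(1)=0$. For $c\in[0,1]$ let $\mathcal S_c$ be the set of all $\mathbb F$-adapted processes $\nu=(\nu_t)_{t\ge0}$ whose paths are, $\mathsf P$-a.s., nonnegative, nondecreasing and left-continuous, with $\nu_0=0$ and $c+\nu_t\le 1$ for all $t\ge 0$. Put $C^{c,\nu}_t:=c+\nu_t$. Define $$U(x,c):=\inf_{\nu\in\mathcal S_c}\mathsf E\Big[\int_0^\infty e^{-\lambda s}\lambda X^x_s\,\Phi(C^{c,\nu}_s)\,ds+\int_{[0,\infty)} e^{-\lambda s}X^x_s\,d\nu_s\Big]$$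 and $$\hat U(x,c):=\inf_{\nu\in\mathcal S_c,\ \tau}\mathsf E\Big[\int_0^{\tau} e^{-\lambda s}\lambda X^x_s\,\Phi(C^{c,\nu}_s)\,ds+\int_{[0,\tau)} e^{-\lambda s}X^x_s\,d\nu_s+e^{-\lambda\tau}X^x_\tau\,(1-C^{c,\nu}_\tau)\Big],$$ where $\tau$ ranges over all $\mathsf P$-a.s. finite $\mathbb F$-stopping times, and $d\nu$ is the Lebesgue–Stieltjes measure with $d\nu([a,b))=\nu_b-\nu_a$ for $0\le a\le b$ (so a jump $\nu_{t+}-\nu_t$ is an atom at $t$, also at $t=0$). Then, for every $(x,c)\in\mathbb R\times[0,1]$, all these costs are well defined (for every $\nu\in\mathcal S_c$ the pathwise integrals over the whole half-line converge absolutely $\mathsf P$-a.s., and the random variables inside both expectations are integrable), both infima are finite, and $$U(x,c)=\hat U(x,c).$$ -/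

import Mathlib

open MeasureTheory ProbabilityTheory Set
open scoped NNReal

namespace StorageControl

variable {Ω : Type*} {mΩ : MeasurableSpace Ω}

/-- The filtration generated by the process `B`, augmented by all `P`-null sets. On a complete
probability space every `P`-null set is measurable, so this is a sub-filtration of `mΩ`. -/
noncomputable def augmentedFiltration (P : Measure Ω) [P.IsComplete] (B : ℝ≥0 → Ω → ℝ)
    (hB : ∀ t, Measurable (B t)) : Filtration ℝ≥0 mΩ where
  seq t := (⨆ s ≤ t, MeasurableSpace.comap (B s) inferInstance) ⊔
    MeasurableSpace.generateFrom {N : Set Ω | P N = 0}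
  mono' _ _ hij := sup_le_sup_right (biSup_mono fun _ h => h.trans hij) _
  le' t := by
    refine sup_le (iSup₂_le fun s _ => (hB s).comap_le) ?_
    exact MeasurableSpace.generateFrom_le fun N hN => Measure.IsComplete.out' N hN

/-- `X` is a strong solution of `dX_t = θ (m - X_t) dt + σ dB_t`, `X_0 = x`: it is adapted, has
continuous paths and satisfies the equation in integrated form. As the noise is additive, the
stochastic integral `∫_0^t σ dB_s` is `σ * B_t`. -/
structure IsOrnsteinUhlenbeck (P : Measure Ω) (𝓕 : Filtration ℝ≥0 mΩ) (B : ℝ≥0 → Ω → ℝ)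
    (θ m σ x : ℝ) (X : ℝ≥0 → Ω → ℝ) : Prop where
  adapted : Adapted 𝓕 X
  continuous_paths : ∀ᵐ ω ∂P, Continuous fun t => X t ω
  equation : ∀ᵐ ω ∂P, ∀ t : ℝ≥0,
    X t ω = x + (∫ s in (0 : ℝ)..t, θ * (m - X s.toNNReal ω)) + σ * B t ω

/-- The admissible controls: adapted processes whose paths are, almost surely, nondecreasing,
left-continuous, zero at time `0` (hence nonnegative) and such that `c + ν_t ≤ 1` for all `t`. -/
structure IsAdmissible (P : Measure Ω) (𝓕 : Filtration ℝ≥0 mΩ) (c : ℝ)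
    (ν : ℝ≥0 → Ω → ℝ) : Prop where
  adapted : Adapted 𝓕 ν
  monotone : ∀ᵐ ω ∂P, Monotone fun t => ν t ω
  left_continuous : ∀ᵐ ω ∂P, ∀ t : ℝ≥0, ContinuousWithinAt (fun s => ν s ω) (Iic t) t
  zero : ∀ᵐ ω ∂P, ν 0 ω = 0
  capacity : ∀ᵐ ω ∂P, ∀ t : ℝ≥0, c + ν t ω ≤ 1

open Classical in
/-- The Lebesgue-Stieltjes measure `dg` on the half-line `[0, ∞)` of a nondecreasing
`g : [0, ∞) → ℝ`, as a measure on `ℝ` vanishing on the negative reals: `g` is extended to the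
left by the constant `g 0`. If `g` is left-continuous then `dg [a, b) = g b - g a` for
`0 ≤ a ≤ b`, so that a jump `g (t+) - g t` is an atom at `t`, also for `t = 0`.
(Value `0` if `g` is not nondecreasing.) -/
noncomputable def stieltjesMeasure (g : ℝ≥0 → ℝ) : Measure ℝ :=
  if h : Monotone g then (h.comp fun _ _ hst => Real.toNNReal_mono hst).stieltjesFunction.measure else 0

/-- The integrand `e^{-λ s} λ X_s Φ(c + ν_s)` of the running cost along a path `X = ξ`, `ν = g`. -/
noncomputable def runningIntegrand (lam : ℝ) (Φ : ℝ → ℝ) (c : ℝ) (ξ g : ℝ≥0 → ℝ) (s : ℝ) : ℝ :=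
  Real.exp (-lam * s) * lam * ξ s.toNNReal * Φ (c + g s.toNNReal)

/-- The discounted price `e^{-λ s} X_s` along a path `X = ξ`. -/
noncomputable def discountedPrice (lam : ℝ) (ξ : ℝ≥0 → ℝ) (s : ℝ) : ℝ :=
  Real.exp (-lam * s) * ξ s.toNNReal

/-- The pathwise total cost
`∫_0^∞ e^{-λ s} λ X_s Φ(c + ν_s) ds + ∫_{[0,∞)} e^{-λ s} X_s dν_s`. -/
noncomputable def totalCost (lam : ℝ) (Φ : ℝ → ℝ) (c : ℝ) (ξ g : ℝ≥0 → ℝ) : ℝ :=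
  (∫ s in Ioi (0 : ℝ), runningIntegrand lam Φ c ξ g s) +
    ∫ s in Ici (0 : ℝ), discountedPrice lam ξ s ∂(stieltjesMeasure g)

/-- The pathwise cost when stopping at time `T` and buying all the remaining capacity:
`∫_0^T e^{-λ s} λ X_s Φ(c + ν_s) ds + ∫_{[0,T)} e^{-λ s} X_s dν_s
  + e^{-λ T} X_T (1 - (c + ν_T))`. -/
noncomputable def stoppedCost (lam : ℝ) (Φ : ℝ → ℝ) (c : ℝ) (ξ g : ℝ≥0 → ℝ) (T : ℝ≥0) : ℝ :=
  (∫ s in (0 : ℝ)..T, runningIntegrand lam Φ c ξ g s) +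
    (∫ s in Ico (0 : ℝ) T, discountedPrice lam ξ s ∂(stieltjesMeasure g)) +
    Real.exp (-lam * T) * ξ T * (1 - (c + g T))

/-- The total cost as a random variable. -/
noncomputable def controlCost (lam : ℝ) (Φ : ℝ → ℝ) (c : ℝ) (X ν : ℝ≥0 → Ω → ℝ) (ω : Ω) : ℝ :=
  totalCost lam Φ c (fun t => X t ω) (fun t => ν t ω)

/-- The cost of the control `ν` together with the (a.s. finite) stopping time `τ`, as a random
variable. -/
noncomputable def discretionaryCost (lam : ℝ) (Φ : ℝ → ℝ) (c : ℝ) (X ν : ℝ≥0 → Ω → ℝ)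
    (τ : Ω → WithTop ℝ≥0) (ω : Ω) : ℝ :=
  stoppedCost lam Φ c (fun t => X t ω) (fun t => ν t ω) (τ ω).untopA

/-- All expected costs of admissible controls. -/
def controlValues (P : Measure Ω) (𝓕 : Filtration ℝ≥0 mΩ) (lam : ℝ) (Φ : ℝ → ℝ) (c : ℝ)
    (X : ℝ≥0 → Ω → ℝ) : Set ℝ :=
  {r | ∃ ν, IsAdmissible P 𝓕 c ν ∧ r = ∫ ω, controlCost lam Φ c X ν ω ∂P}

/-- All expected costs of pairs of an admissible control and an a.s. finite stopping time. -/
def discretionaryValues (P : Measure Ω) (𝓕 : Filtration ℝ≥0 mΩ) (lam : ℝ) (Φ : ℝ → ℝ) (c : ℝ)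
    (X : ℝ≥0 → Ω → ℝ) : Set ℝ :=
  {r | ∃ ν τ, IsAdmissible P 𝓕 c ν ∧ IsStoppingTime 𝓕 τ ∧ (∀ᵐ ω ∂P, τ ω ≠ ⊤) ∧
    r = ∫ ω, discretionaryCost lam Φ c X ν τ ω ∂P}

/-- The value `U` of the singular control problem. -/
noncomputable def controlValue (P : Measure Ω) (𝓕 : Filtration ℝ≥0 mΩ) (lam : ℝ) (Φ : ℝ → ℝ)
    (c : ℝ) (X : ℝ≥0 → Ω → ℝ) : ℝ :=
  sInf (controlValues P 𝓕 lam Φ c X)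

/-- The value `Û` of the singular control problem with discretionary stopping. -/
noncomputable def discretionaryValue (P : Measure Ω) (𝓕 : Filtration ℝ≥0 mΩ) (lam : ℝ)
    (Φ : ℝ → ℝ) (c : ℝ) (X : ℝ≥0 → Ω → ℝ) : ℝ :=
  sInf (discretionaryValues P 𝓕 lam Φ c X)

end StorageControl

open StorageControl

namespace StorageControl

open Filter
open scoped ENNReal Topology

/-! ### Brownian paths grow subexponentially, in mean -/

/-! Stopping adds nothing because $\Phi(1)=0$. Given $(\nu,\tau)$, follow $\nu$ up to $\tau$ and
then jump to full capacity: the running cost vanishes after $\tau$, and the jump is an atom at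
$\tau$ that costs exactly the terminal payment. So the stopped cost is the total cost of another
admissible control (`totalCost_fillAfter`, `discretionaryValues_subset`), which gives $U\le\hat U$.
Conversely, stop a control $\nu$ at the deterministic times $n$: the terminal payment tends to $0$,
the stopped costs converge to the total cost, and dominated convergence gives $\hat U\le U$
(`tendsto_integral_discretionaryCost`).

Integrability and domination rest on an integrable $M$ with $|X_t|\le e^{\lambda t/2}M$ for all $t$.
For Brownian motion such a bound comes from fourth-moment dyadic chaining on each $[n,n+1]$, summed
over $n$ with exponential weights (`exists_integrable_brownian_bound`); a pathwise comparison for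
the linear equation carries it over to $X$ (`abs_le_of_linear_ode`). Since $d\nu$ has mass at most
$1$ and $0\le\Phi\le\Phi(0)$ along the control, every cost is at most $(2\Phi(0)+1)M$ in absolute
value. Measurability of the costs comes from viewing $\omega\mapsto d\nu(\omega)$ as a finite
kernel. -/

/-- The fourth moment of the standard normal law. -/
noncomputable def gaussianFourthMoment : ℝ≥0∞ := ∫⁻ x, ‖x‖ₑ ^ 4 ∂(gaussianReal 0 1)

lemma gaussianFourthMoment_lt_top : gaussianFourthMoment < ⊤ := by
  have h := (memLp_id_gaussianReal (μ := 0) (v := 1) 4).eLpNorm_lt_top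
  rw [eLpNorm_lt_top_iff_lintegral_rpow_enorm_lt_top (by simp) (by simp)] at h
  refine lt_of_eq_of_lt ?_ h
  refine lintegral_congr fun x => ?_
  simp only [id, ENNReal.coe_ofNat, ENNReal.toReal_ofNat]
  norm_cast

lemma lintegral_enorm_pow_four_gaussianReal (v : ℝ≥0) :
    ∫⁻ x, ‖x‖ₑ ^ 4 ∂(gaussianReal 0 v) = (v : ℝ≥0∞) ^ 2 * gaussianFourthMoment := by
  have h := gaussianReal_map_const_mul (μ := 0) (v := 1) (√(v : ℝ))
  have hv : NNReal.mk (√(v : ℝ) ^ 2) (sq_nonneg _) * 1 = v := by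
    ext
    simp
  rw [mul_zero, hv] at h
  rw [← h, lintegral_map (by fun_prop) (by fun_prop), gaussianFourthMoment,
    ← lintegral_const_mul _ (by fun_prop)]
  refine lintegral_congr fun x => ?_
  have h2 : ‖√(v : ℝ)‖ₑ ^ 4 = (v : ℝ≥0∞) ^ 2 := by
    rw [Real.enorm_of_nonneg (Real.sqrt_nonneg _), ← ENNReal.ofReal_pow (Real.sqrt_nonneg _),
      show (4 : ℕ) = 2 * 2 from rfl, pow_mul, Real.sq_sqrt v.coe_nonneg, ENNReal.ofReal_pow v.coe_nonneg,
      ENNReal.ofReal_coe_nnreal]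
  rw [enorm_mul, mul_pow, h2]

/-- Dyadic chaining: the increments of `f` over the dyadic intervals of `[n, n + 1]` control the
oscillation of `f` on the dyadic points. -/
lemma enorm_sub_dyadic_le (f : ℝ≥0 → ℝ) (n : ℝ≥0) (d : ℕ → ℝ≥0∞)
    (h : ∀ k : ℕ, ∀ j < 2 ^ k,
      ‖f (n + ((j + 1 : ℕ) : ℝ≥0) / 2 ^ k) - f (n + (j : ℝ≥0) / 2 ^ k)‖ₑ ≤ d k)
    (k j : ℕ) (hj : j ≤ 2 ^ k) :
    ‖f (n + (j : ℝ≥0) / 2 ^ k) - f n‖ₑ ≤ ∑ i ∈ Finset.range (k + 1), d i := by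
  induction k generalizing j with
  | zero =>
    have hj' : j = 0 ∨ j = 1 := by simp at hj; omega
    rcases hj' with rfl | rfl
    · simp
    · simpa using h 0 0 (by simp)
  | succ k ih =>
    have even : ∀ i : ℕ, ((2 * i : ℕ) : ℝ≥0) / 2 ^ (k + 1) = (i : ℝ≥0) / 2 ^ k := by
      intro i
      push_cast
      rw [pow_succ']
      exact mul_div_mul_left _ _ two_ne_zero
    rw [Finset.sum_range_succ]
    obtain ⟨i, rfl | rfl⟩ : ∃ i, j = 2 * i ∨ j = 2 * i + 1 := ⟨j / 2, by omega⟩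
    · rw [even]
      exact (ih i (by rw [pow_succ] at hj; omega)).trans le_self_add
    · have hi := ih i (by rw [pow_succ] at hj; omega)
      have hd := h (k + 1) (2 * i) (by omega)
      rw [even] at hd
      refine (le_trans ?_ (enorm_add_le (f (n + (i : ℝ≥0) / 2 ^ k) - f n) _)).trans
        (add_le_add hi hd)
      apply le_of_eq
      congr 1
      ring

/-- The dyadic points $\lfloor t2^k\rfloor/2^k$ converge to $t$, so continuity carries the chaining
bound over to all of $[n,n+1]$. -/
lemma enorm_le_of_dyadic_increments (f : ℝ≥0 → ℝ) (hf : Continuous f) (n : ℝ≥0) (d : ℕ → ℝ≥0∞)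
    (h : ∀ k : ℕ, ∀ j < 2 ^ k,
      ‖f (n + ((j + 1 : ℕ) : ℝ≥0) / 2 ^ k) - f (n + (j : ℝ≥0) / 2 ^ k)‖ₑ ≤ d k)
    (t : ℝ≥0) (ht : t ≤ 1) :
    ‖f (n + t)‖ₑ ≤ ‖f n‖ₑ + ∑' i, d i := by
  have lim : Tendsto (fun k : ℕ => n + ((⌊(t : ℝ) * 2 ^ k⌋₊ : ℕ) : ℝ≥0) / 2 ^ k) atTop (𝓝 (n + t)) := by
    refine tendsto_const_nhds.add ?_
    rw [← NNReal.tendsto_coe]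
    have := (tendsto_nat_floor_mul_div_atTop t.coe_nonneg).comp
      (tendsto_pow_atTop_atTop_of_one_lt (one_lt_two : (1 : ℝ) < 2))
    refine this.congr fun k => ?_
    simp
  have lim2 := (((hf.tendsto _).comp lim).sub_const (f n)).enorm
  have : ‖f (n + t) - f n‖ₑ ≤ ∑' i, d i := by
    refine le_of_tendsto lim2 (Eventually.of_forall fun k => ?_)
    refine (enorm_sub_dyadic_le f n d h k _ ?_).trans (ENNReal.sum_le_tsum _)
    refine Nat.floor_le_of_le ?_
    push_cast
    exact mul_le_of_le_one_left (by positivity) (by exact_mod_cast ht)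
  calc ‖f (n + t)‖ₑ = ‖f n + (f (n + t) - f n)‖ₑ := by congr 1; ring
    _ ≤ _ := (enorm_add_le _ _).trans (add_le_add le_rfl this)

/-- Young's inequality in the form `a ≤ ε + a ^ 4 / ε ^ 3`. -/
lemma le_add_pow_four_div (a ε : ℝ≥0∞) (h0 : ε ≠ 0) (ht : ε ≠ ⊤) :
    a ≤ ε + a ^ 4 * (ε⁻¹) ^ 3 := by
  rcases le_total a ε with h | h
  · exact h.trans le_self_add
  · refine le_trans ?_ le_add_self
    calc a = a * (ε * ε⁻¹) ^ 3 := by rw [ENNReal.mul_inv_cancel h0 ht]; simp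
      _ = a * ε ^ 3 * (ε⁻¹) ^ 3 := by ring
      _ ≤ a * a ^ 3 * (ε⁻¹) ^ 3 := by gcongr
      _ = _ := by ring

variable {Ω : Type*} {mΩ : MeasurableSpace Ω}

/-- The chaining bound for the increments of order `k` over `[n, n + 1]`. -/
noncomputable def chainingBound (B : ℝ≥0 → Ω → ℝ) (n : ℝ≥0) (k : ℕ) (ω : Ω) : ℝ≥0∞ :=
  ENNReal.ofReal ((9 / 10) ^ k) + ∑ j ∈ Finset.range (2 ^ k),
    ‖B (n + ((j + 1 : ℕ) : ℝ≥0) / 2 ^ k) ω - B (n + (j : ℝ≥0) / 2 ^ k) ω‖ₑ ^ 4 *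
      ((ENNReal.ofReal ((9 / 10) ^ k))⁻¹) ^ 3

lemma measurable_chainingBound {B : ℝ≥0 → Ω → ℝ} (hBm : ∀ t, Measurable (B t)) (n : ℝ≥0) (k : ℕ) :
    Measurable (chainingBound B n k) := by
  unfold chainingBound
  have := hBm
  fun_prop

/-- Young's inequality with $\varepsilon=(9/10)^k$; the sum of the fourth powers replaces their
maximum over $j$ and has a computable mean. -/
lemma increment_le_chainingBound (B : ℝ≥0 → Ω → ℝ) (n : ℝ≥0) (k j : ℕ) (hj : j < 2 ^ k) (ω : Ω) :
    ‖B (n + ((j + 1 : ℕ) : ℝ≥0) / 2 ^ k) ω - B (n + (j : ℝ≥0) / 2 ^ k) ω‖ₑ ≤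
      chainingBound B n k ω := by
  refine (le_add_pow_four_div _ (ENNReal.ofReal ((9 / 10) ^ k)) (by simp)
    (by simp)).trans ?_
  refine add_le_add le_rfl ?_
  exact Finset.single_le_sum (f := fun j : ℕ =>
    ‖B (n + ((j + 1 : ℕ) : ℝ≥0) / 2 ^ k) ω - B (n + (j : ℝ≥0) / 2 ^ k) ω‖ₑ ^ 4 *
      ((ENNReal.ofReal ((9 / 10) ^ k))⁻¹) ^ 3) (fun _ _ => zero_le) (Finset.mem_range.2 hj)

/-- An increment of order $k$ has variance $2^{-k}$, hence fourth moment proportional to $4^{-k}$.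
With $2^k$ of them, each divided by $(9/10)^{3k}$, the ratio is
$2\cdot\frac14\cdot(\frac{10}{9})^3=\frac{500}{729}<1$; the base $9/10$ makes both this and the
threshold series summable. The value does not depend on $n$. -/
lemma lintegral_chainingBound {P : Measure Ω} [IsProbabilityMeasure P] {B : ℝ≥0 → Ω → ℝ}
    (hBm : ∀ t, Measurable (B t)) (hB : IsPreBrownianReal B P) (n : ℝ≥0) (k : ℕ) :
    ∫⁻ ω, chainingBound B n k ω ∂P =
      ENNReal.ofReal ((9 / 10) ^ k) +
        gaussianFourthMoment * ENNReal.ofReal ((500 / 729) ^ k) := by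
  have hinc : ∀ j : ℕ, ∫⁻ ω, ‖B (n + ((j + 1 : ℕ) : ℝ≥0) / 2 ^ k) ω -
      B (n + (j : ℝ≥0) / 2 ^ k) ω‖ₑ ^ 4 ∂P =
      ENNReal.ofReal ((1 / 4) ^ k) * gaussianFourthMoment := by
    intro j
    have law := hB.hasLaw_sub (n + ((j + 1 : ℕ) : ℝ≥0) / 2 ^ k) (n + (j : ℝ≥0) / 2 ^ k)
    have e := law.lintegral_comp (f := fun x => ‖x‖ₑ ^ 4) (by fun_prop)
    simp only [Pi.sub_apply] at e
    refine e.trans ?_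
    rw [lintegral_enorm_pow_four_gaussianReal]
    congr 1
    have : nndist ((n + ((j + 1 : ℕ) : ℝ≥0) / 2 ^ k : ℝ≥0) : ℝ)
        ((n + (j : ℝ≥0) / 2 ^ k : ℝ≥0) : ℝ) = (1 / 2) ^ k := by
      ext
      rw [coe_nndist, Real.dist_eq]
      push_cast
      rw [show (n : ℝ) + ((j : ℝ) + 1) / 2 ^ k - (n + j / 2 ^ k) = (1 / 2) ^ k by
        rw [one_div, inv_pow]; ring, abs_of_nonneg (by positivity)]
    refine (congrArg (fun v : ℝ≥0 => (v : ℝ≥0∞) ^ 2) this).trans ?_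
    rw [← ENNReal.coe_pow, ← ENNReal.ofReal_coe_nnreal]
    congr 1
    push_cast
    rw [← pow_mul, mul_comm, pow_mul]
    norm_num
  unfold chainingBound
  rw [lintegral_add_left (by fun_prop), lintegral_finsetSum _ (by have := hBm; fun_prop)]
  congr 1
  · simp
  · have : ∀ j : ℕ, ∫⁻ ω, ‖B (n + ((j + 1 : ℕ) : ℝ≥0) / 2 ^ k) ω -
      B (n + (j : ℝ≥0) / 2 ^ k) ω‖ₑ ^ 4 * ((ENNReal.ofReal ((9 / 10) ^ k))⁻¹) ^ 3 ∂P =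
      gaussianFourthMoment *
        (ENNReal.ofReal ((1 / 4) ^ k) * ((ENNReal.ofReal ((9 / 10) ^ k))⁻¹) ^ 3) := by
      intro j
      rw [lintegral_mul_const _ (by have := hBm; fun_prop), hinc]
      ring
    simp_rw [this]
    rw [Finset.sum_const, Finset.card_range, nsmul_eq_mul, mul_left_comm]
    congr 1
    rw [← ENNReal.ofReal_inv_of_pos (by positivity), ← ENNReal.ofReal_pow (by positivity),
      ← ENNReal.ofReal_mul (by positivity), ← ENNReal.ofReal_natCast,
      ← ENNReal.ofReal_mul (by positivity)]
    congr 1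
    push_cast
    rw [← inv_pow, ← pow_mul, mul_comm k 3, pow_mul, ← mul_pow, ← mul_pow]
    norm_num

lemma exists_lintegral_tsum_chainingBound_le {P : Measure Ω} [IsProbabilityMeasure P]
    {B : ℝ≥0 → Ω → ℝ} (hBm : ∀ t, Measurable (B t)) (hB : IsPreBrownianReal B P) :
    ∃ C : ℝ≥0∞, C ≠ ⊤ ∧ ∀ n, ∫⁻ ω, ∑' k, chainingBound B n k ω ∂P ≤ C := by
  refine ⟨∑' k : ℕ, (ENNReal.ofReal ((9 / 10) ^ k) +
    gaussianFourthMoment * ENNReal.ofReal ((500 / 729) ^ k)), ?_, fun n => ?_⟩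
  · rw [ENNReal.tsum_add, ENNReal.tsum_mul_left]
    refine ENNReal.add_ne_top.2 ⟨?_, ENNReal.mul_ne_top gaussianFourthMoment_lt_top.ne ?_⟩
    · exact (summable_geometric_of_lt_one (by norm_num) (by norm_num)).tsum_ofReal_ne_top
    · exact (summable_geometric_of_lt_one (by norm_num) (by norm_num)).tsum_ofReal_ne_top
  · rw [lintegral_tsum fun k => (measurable_chainingBound hBm n k).aemeasurable]
    simp_rw [lintegral_chainingBound hBm hB]
    exact le_rfl

/-- For every `a > 0`, `sup_t e^{-a t} |B_t|` is dominated by an integrable random variable. -/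
theorem exists_integrable_brownian_bound {P : Measure Ω} [IsProbabilityMeasure P]
    {B : ℝ≥0 → Ω → ℝ} (hBm : ∀ t, Measurable (B t)) (hB : IsBrownianReal B P) {a : ℝ}
    (ha : 0 < a) :
    ∃ M : Ω → ℝ, Integrable M P ∧ (∀ ω, 0 ≤ M ω) ∧
      ∀ᵐ ω ∂P, ∀ t : ℝ≥0, |B t ω| ≤ Real.exp (a * t) * M ω := by
  obtain ⟨C, hC, hCle⟩ := exists_lintegral_tsum_chainingBound_le hBm hB.toIsPreBrownianReal
  -- The supremum over the unit intervals is replaced by a weighted sum, whose mean converges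
  -- because the $n$-th term grows only polynomially before weighting.
  set N : Ω → ℝ≥0∞ := fun ω => ∑' n : ℕ, ENNReal.ofReal (Real.exp (-(a * n))) *
    (‖B n ω‖ₑ + ∑' k, chainingBound B n k ω) with hN
  have hmeas : ∀ n : ℕ, Measurable fun ω => ‖B n ω‖ₑ + ∑' k, chainingBound B n k ω := fun n =>
    (hBm n).enorm.add (Measurable.tsum fun k => measurable_chainingBound hBm n k)
  have hNm : Measurable N := Measurable.tsum fun n => (hmeas n).const_mul _
  have hBn : ∀ n : ℕ, ∫⁻ ω, ‖B n ω‖ₑ ∂P ≤ 1 + (n : ℝ≥0∞) ^ 2 * gaussianFourthMoment := by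
    intro n
    calc ∫⁻ ω, ‖B n ω‖ₑ ∂P ≤ ∫⁻ ω, (1 + ‖B n ω‖ₑ ^ 4) ∂P :=
          lintegral_mono fun ω => by simpa using le_add_pow_four_div ‖B n ω‖ₑ 1 (by simp) (by simp)
      _ = _ := by
          rw [lintegral_add_left (by fun_prop)]
          have e := (hB.hasLaw_eval n).lintegral_comp (f := fun x => ‖x‖ₑ ^ 4) (by fun_prop)
          rw [e, lintegral_enorm_pow_four_gaussianReal]
          simp
  have hNint : ∫⁻ ω, N ω ∂P ≠ ⊤ := by
    rw [hN, lintegral_tsum fun n => ((hmeas n).const_mul _).aemeasurable]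
    have hle : ∀ n : ℕ, ∫⁻ ω, ENNReal.ofReal (Real.exp (-(a * n))) *
        (‖B n ω‖ₑ + ∑' k, chainingBound B n k ω) ∂P ≤
        ENNReal.ofReal ((n : ℝ) ^ 0 * Real.exp (-a * n)) * (1 + C) +
          ENNReal.ofReal ((n : ℝ) ^ 2 * Real.exp (-a * n)) * gaussianFourthMoment := by
      intro n
      rw [lintegral_const_mul _ (hmeas n), lintegral_add_left (hBm n).enorm]
      refine (mul_le_mul_right (add_le_add (hBn n) (hCle n)) _).trans (le_of_eq ?_)
      rw [ENNReal.ofReal_mul (by positivity), ENNReal.ofReal_mul (by positivity),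
        ENNReal.ofReal_pow (by positivity), ENNReal.ofReal_pow (by positivity),
        ENNReal.ofReal_natCast, neg_mul]
      ring
    refine ((ENNReal.tsum_le_tsum hle).trans_lt ?_).ne
    rw [ENNReal.tsum_add, ENNReal.tsum_mul_right, ENNReal.tsum_mul_right]
    have hs : ∀ p : ℕ, ∑' n : ℕ, ENNReal.ofReal ((n : ℝ) ^ p * Real.exp (-a * n)) < ⊤ := by
      intro p
      exact (Real.summable_pow_mul_exp_neg_nat_mul p ha).tsum_ofReal_lt_top
    exact ENNReal.add_lt_top.2 ⟨ENNReal.mul_lt_top (hs 0) (ENNReal.add_lt_top.2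
      ⟨ENNReal.one_lt_top, hC.lt_top⟩), ENNReal.mul_lt_top (hs 2) gaussianFourthMoment_lt_top⟩
  -- The factor `Real.exp a` is mere slack: $\lfloor t\rfloor\le t$ already gives $|B_t|\le
  -- e^{at}N$.
  refine ⟨fun ω => Real.exp a * (N ω).toReal, (integrable_toReal_of_lintegral_ne_top
    hNm.aemeasurable hNint).const_mul _, fun ω => by positivity, ?_⟩
  filter_upwards [hB.cont, ae_lt_top hNm hNint] with ω hc hfin t
  set n : ℕ := ⌊t⌋₊
  have hnt : (n : ℝ≥0) ≤ t := Nat.floor_le zero_le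
  have hnt' : t < n + 1 := Nat.lt_floor_add_one t
  have h1 := enorm_le_of_dyadic_increments (fun s => B s ω) hc n (fun k => chainingBound B n k ω)
    (fun k j hj => increment_le_chainingBound B n k j hj ω) (t - n)
    (tsub_le_iff_left.2 hnt'.le)
  rw [add_tsub_cancel_of_le hnt] at h1
  have h2 : ENNReal.ofReal (Real.exp (-(a * n))) * ‖B t ω‖ₑ ≤ N ω :=
    (mul_le_mul_right h1 _).trans (ENNReal.le_tsum n)
  have h3 := ENNReal.toReal_mono hfin.ne h2
  rw [ENNReal.toReal_mul, ENNReal.toReal_ofReal (Real.exp_nonneg _), toReal_enorm,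
    Real.norm_eq_abs] at h3
  have h4 : Real.exp (a * n) ≤ Real.exp (a * t) :=
    Real.exp_le_exp.2 (mul_le_mul_of_nonneg_left (by exact_mod_cast hnt) ha.le)
  have h5 : (1 : ℝ) ≤ Real.exp a := Real.one_le_exp ha.le
  have h6 : (0 : ℝ) ≤ (N ω).toReal := ENNReal.toReal_nonneg
  calc |B t ω| = Real.exp (a * n) * (Real.exp (-(a * n)) * |B t ω|) := by
        rw [← mul_assoc, ← Real.exp_add]; simp
    _ ≤ Real.exp (a * t) * (N ω).toReal := by gcongr
    _ ≤ Real.exp (a * t) * (Real.exp a * (N ω).toReal) := by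
        gcongr
        exact le_mul_of_one_le_left h6 h5

/-! ### Pathwise bound for the Ornstein-Uhlenbeck process -/

/-- Removing the noise leaves $y'=\theta(m-y-b)$, so $e^{\theta t}(y-L)$ has derivative $\theta
e^{\theta t}(m-b-L)$. For $L=\pm(|y_0|+m+K)$ its sign is constant on $[0,T]$, and monotonicity
propagates the bound from time $0$. -/
lemma abs_le_of_linear_ode {θ m T K y₀ : ℝ} {ξ b y : ℝ → ℝ} (hθ : 0 < θ) (hm : 0 < m)
    (hξ : Continuous ξ) (hy : ∀ t, 0 ≤ t → y t = y₀ + ∫ s in (0 : ℝ)..t, θ * (m - ξ s))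
    (hyξ : ∀ t, 0 ≤ t → ξ t = y t + b t) (hb : ∀ t ∈ Icc 0 T, |b t| ≤ K) (hT : 0 ≤ T) :
    |y T| ≤ |y₀| + m + K := by
  have hK : 0 ≤ K := (abs_nonneg _).trans (hb 0 ⟨le_rfl, hT⟩)
  set z : ℝ → ℝ := fun t => y₀ + ∫ s in (0 : ℝ)..t, θ * (m - ξ s) with hz
  have hzd : ∀ t, HasDerivAt z (θ * (m - ξ t)) t := fun t =>
    (Continuous.integral_hasStrictDerivAt (by fun_prop) 0 t).hasDerivAt.const_add y₀
  have hd : ∀ L t, HasDerivAt (fun s => Real.exp (θ * s) * (z s - L))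
      (Real.exp (θ * t) * θ * (z t - L + (m - ξ t))) t := by
    intro L t
    have h1 : HasDerivAt (fun s => Real.exp (θ * s)) (Real.exp (θ * t) * θ) t := by
      simpa using ((hasDerivAt_id t).const_mul θ).exp
    exact (h1.mul ((hzd t).sub_const L)).congr_deriv (by ring)
  have hzξ : ∀ t, 0 ≤ t → ξ t = z t + b t := fun t ht => by rw [hyξ t ht, hy t ht]
  have hz0 : z 0 = y₀ := by simp [hz]
  have hcont : ∀ L, ContinuousOn (fun s => Real.exp (θ * s) * (z s - L)) (Icc 0 T) :=
    fun L t _ => (hd L t).continuousAt.continuousWithinAt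
  have hy0 := neg_abs_le y₀
  have hy0' := le_abs_self y₀
  rw [hy T hT, abs_le]
  constructor
  · have mono := monotoneOn_of_deriv_nonneg (convex_Icc 0 T) (hcont (-(|y₀| + m + K)))
      (fun t _ => (hd _ t).differentiableAt.differentiableWithinAt) (fun t ht => by
        rw [interior_Icc] at ht
        rw [(hd _ t).deriv, hzξ t ht.1.le]
        have := abs_le.1 (hb t ⟨ht.1.le, ht.2.le⟩)
        refine mul_nonneg (by positivity) ?_
        linarith [abs_nonneg y₀])
    have h := mono ⟨le_rfl, hT⟩ ⟨hT, le_rfl⟩ hT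
    simp only [mul_zero, Real.exp_zero, one_mul, hz0] at h
    have h2 : 0 ≤ Real.exp (θ * T) * (z T - -(|y₀| + m + K)) := le_trans (by linarith) h
    have h3 := nonneg_of_mul_nonneg_right h2 (Real.exp_pos _)
    linarith
  · have anti := antitoneOn_of_deriv_nonpos (convex_Icc 0 T) (hcont (|y₀| + m + K))
      (fun t _ => (hd _ t).differentiableAt.differentiableWithinAt) (fun t ht => by
        rw [interior_Icc] at ht
        rw [(hd _ t).deriv, hzξ t ht.1.le]
        have := abs_le.1 (hb t ⟨ht.1.le, ht.2.le⟩)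
        refine mul_nonpos_of_nonneg_of_nonpos (by positivity) ?_
        linarith [abs_nonneg y₀])
    have h := anti ⟨le_rfl, hT⟩ ⟨hT, le_rfl⟩ hT
    simp only [mul_zero, Real.exp_zero, one_mul, hz0] at h
    have h2 : Real.exp (θ * T) * (z T - (|y₀| + m + K)) ≤ 0 := le_trans h (by linarith)
    have h3 := nonpos_of_mul_nonpos_right h2 (Real.exp_pos _)
    linarith

/-- For every `a > 0`, `sup_t e^{-a t} |X_t|` is dominated by an integrable random variable. -/
theorem IsOrnsteinUhlenbeck.exists_integrable_bound {P : Measure Ω} [IsProbabilityMeasure P]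
    {𝓕 : Filtration ℝ≥0 mΩ} {B X : ℝ≥0 → Ω → ℝ} {θ m σ x a : ℝ}
    (hX : IsOrnsteinUhlenbeck P 𝓕 B θ m σ x X) (hBm : ∀ t, Measurable (B t))
    (hB : IsBrownianReal B P) (hθ : 0 < θ) (hm : 0 < m) (hσ : 0 < σ) (ha : 0 < a) :
    ∃ M : Ω → ℝ, Integrable M P ∧ (∀ ω, 0 ≤ M ω) ∧
      ∀ᵐ ω ∂P, ∀ t : ℝ≥0, |X t ω| ≤ Real.exp (a * t) * M ω := by
  obtain ⟨M, hM, hM0, hMB⟩ := exists_integrable_brownian_bound hBm hB ha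
  refine ⟨fun ω => |x| + m + 2 * σ * M ω, (integrable_const _).add (hM.const_mul _),
    fun ω => by have := hM0 ω; positivity, ?_⟩
  filter_upwards [hMB, hX.continuous_paths, hX.equation] with ω hω hc he t
  have hM0 := hM0 ω
  have hbound : ∀ s ∈ Icc (0 : ℝ) t, |σ * B s.toNNReal ω| ≤ σ * (Real.exp (a * t) * M ω) := by
    intro s hs
    rw [abs_mul, abs_of_pos hσ]
    refine mul_le_mul_of_nonneg_left ((hω s.toNNReal).trans ?_) hσ.le
    rw [Real.coe_toNNReal s hs.1]
    gcongr
    exact hs.2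
  have key := abs_le_of_linear_ode (θ := θ) (m := m) (T := t) (y₀ := x)
    (ξ := fun s => X s.toNNReal ω) (b := fun s => σ * B s.toNNReal ω)
    (y := fun s => x + ∫ r in (0 : ℝ)..s, θ * (m - X r.toNNReal ω)) hθ hm
    (hc.comp continuous_real_toNNReal) (fun s _ => rfl)
    (fun s hs => by rw [he s.toNNReal, Real.coe_toNNReal s hs]) hbound t.coe_nonneg
  have hXt := he t
  have hbt := hbound t ⟨t.coe_nonneg, le_rfl⟩
  rw [Real.toNNReal_coe] at hbt
  have h1 : (1 : ℝ) ≤ Real.exp (a * t) := Real.one_le_exp (by positivity)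
  have h2 : |x| + m ≤ Real.exp (a * t) * (|x| + m) := le_mul_of_one_le_left (by positivity) h1
  rw [hXt]
  calc _ ≤ (|x| + m + σ * (Real.exp (a * t) * M ω)) + σ * (Real.exp (a * t) * M ω) :=
        (abs_add_le _ _).trans (add_le_add key hbt)
    _ ≤ Real.exp (a * t) * (|x| + m + 2 * σ * M ω) := by linarith

/-! ### The Stieltjes measure of a left-continuous path -/

/-- A path of an admissible control. -/
structure IsAdmissiblePath (c : ℝ) (g : ℝ≥0 → ℝ) : Prop where
  monotone : Monotone g
  left_continuous : ∀ t, ContinuousWithinAt g (Iic t) t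
  zero : g 0 = 0
  capacity : ∀ t, c + g t ≤ 1

lemma IsAdmissiblePath.nonneg {c : ℝ} {g : ℝ≥0 → ℝ} (hg : IsAdmissiblePath c g) (t : ℝ≥0) :
    0 ≤ g t := hg.zero ▸ hg.monotone zero_le

lemma IsAdmissible.ae_isAdmissiblePath {P : Measure Ω} {𝓕 : Filtration ℝ≥0 mΩ} {c : ℝ}
    {ν : ℝ≥0 → Ω → ℝ} (hν : IsAdmissible P 𝓕 c ν) :
    ∀ᵐ ω ∂P, IsAdmissiblePath c fun t => ν t ω := by
  filter_upwards [hν.monotone, hν.left_continuous, hν.zero, hν.capacity] with ω h1 h2 h3 h4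
  exact ⟨h1, h2, h3, h4⟩

/-- The Stieltjes function is the right-continuous version of $g$, but mass on $[a,b)$ only sees its
left limits; these are the left limits of $g$, hence $g$ itself by left-continuity. -/
lemma stieltjesMeasure_Ico {g : ℝ≥0 → ℝ} (hg : Monotone g)
    (hl : ∀ t, ContinuousWithinAt g (Iic t) t) (a b : ℝ) :
    stieltjesMeasure g (Ico a b) = ENNReal.ofReal (g b.toNNReal - g a.toNNReal) := by
  have hmono : Monotone (g ∘ Real.toNNReal) := hg.comp fun _ _ hst => Real.toNNReal_mono hst
  have hlim : ∀ x, Function.leftLim hmono.stieltjesFunction x = g x.toNNReal := by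
    intro x
    have h1 : Function.leftLim (Function.rightLim (g ∘ Real.toNNReal)) x =
        Function.leftLim (g ∘ Real.toNNReal) x :=
      leftLim_rightLim (hmono.tendsto_leftLim x)
    refine h1.trans (ContinuousWithinAt.leftLim_eq ?_)
    exact (hl x.toNNReal).comp continuous_real_toNNReal.continuousWithinAt
      fun y hy => Real.toNNReal_mono hy
  rw [stieltjesMeasure, dif_pos hg, StieltjesFunction.measure_Ico, hlim, hlim]

lemma measure_univ_eq_iSup_Ico (μ : Measure ℝ) :
    μ univ = ⨆ n : ℕ, μ (Ico (-(n : ℝ)) n) := by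
  have hU : (univ : Set ℝ) = ⋃ n : ℕ, Ico (-(n : ℝ)) n := by
    refine (eq_univ_of_forall fun x => ?_).symm
    obtain ⟨n, hn⟩ := exists_nat_gt |x|
    exact mem_iUnion.2 ⟨n, (abs_lt.1 hn).1.le, (abs_lt.1 hn).2⟩
  have hmono : Monotone fun n : ℕ => Ico (-(n : ℝ)) n := fun i j hij =>
    Ico_subset_Ico (neg_le_neg (by exact_mod_cast hij)) (by exact_mod_cast hij)
  rw [hU, hmono.measure_iUnion]

lemma stieltjesMeasure_univ_le {c : ℝ} (hc : 0 ≤ c) {g : ℝ≥0 → ℝ} (hg : IsAdmissiblePath c g) :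
    stieltjesMeasure g univ ≤ 1 := by
  rw [measure_univ_eq_iSup_Ico]
  refine iSup_le fun n => ?_
  rw [stieltjesMeasure_Ico hg.monotone hg.left_continuous, ← ENNReal.ofReal_one]
  refine ENNReal.ofReal_le_ofReal ?_
  linarith [hg.nonneg (-(n : ℝ)).toNNReal, hg.capacity (n : ℝ).toNNReal]

/-- Follow `g` up to time `T` and then use up the remaining capacity. -/
noncomputable def fillAfter (c : ℝ) (g : ℝ≥0 → ℝ) (T : ℝ≥0) (t : ℝ≥0) : ℝ :=
  if t ≤ T then g t else 1 - c

/-- The switch takes effect strictly after $T$, which preserves left-continuity at $T$; the capacity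
bound makes the jump nonnegative. -/
lemma IsAdmissiblePath.fillAfter {c : ℝ} {g : ℝ≥0 → ℝ} (hg : IsAdmissiblePath c g) (T : ℝ≥0) :
    IsAdmissiblePath c (fillAfter c g T) where
  monotone s t hst := by
    unfold StorageControl.fillAfter
    split_ifs with h1 h2 h2
    · exact hg.monotone hst
    · linarith [hg.capacity s]
    · exact absurd (hst.trans h2) h1
    · exact le_rfl
  left_continuous t := by
    rcases le_or_gt t T with h | h
    · refine (hg.left_continuous t).congr (fun s hs => if_pos (le_trans hs h)) (if_pos h)
    · refine ContinuousAt.continuousWithinAt ?_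
      refine (continuousAt_const (y := 1 - c)).congr ?_
      filter_upwards [Ioi_mem_nhds h] with s hs
      exact (if_neg (not_le.2 hs)).symm
  zero := by simp [StorageControl.fillAfter, hg.zero]
  capacity t := by
    unfold StorageControl.fillAfter
    split_ifs
    · exact hg.capacity t
    · linarith

/-- The restriction is to $(-\infty,T)$ without $T$: a jump of $g$ at $T$ itself is absorbed by the
new jump from $g(T)$ to $1-c$. Finite measures are compared on the intervals $[a,b)$, according to
the position of $T$. -/
lemma stieltjesMeasure_fillAfter {c : ℝ} (hc : 0 ≤ c) {g : ℝ≥0 → ℝ} (hg : IsAdmissiblePath c g)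
    (T : ℝ≥0) :
    stieltjesMeasure (fillAfter c g T) = (stieltjesMeasure g).restrict (Iio (T : ℝ)) +
      ENNReal.ofReal (1 - (c + g T)) • Measure.dirac (T : ℝ) := by
  have hg' := hg.fillAfter T
  refine Measure.ext_of_Ico' _ _ (fun a b _ => ?_) fun a b hab => ?_
  · exact ((measure_mono (subset_univ _)).trans_lt
      ((stieltjesMeasure_univ_le hc hg').trans_lt ENNReal.one_lt_top)).ne
  rw [Measure.add_apply, Measure.smul_apply, Measure.restrict_apply measurableSet_Ico,
    Ico_inter_Iio, stieltjesMeasure_Ico hg.monotone hg.left_continuous,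
    stieltjesMeasure_Ico hg'.monotone hg'.left_continuous, Measure.dirac_apply' _ measurableSet_Ico]
  have hle : ∀ {x : ℝ}, x.toNNReal ≤ T ↔ x ≤ T := fun {x} => Real.toNNReal_le_iff_le_coe
  have hcap := hg.capacity T
  by_cases hb : b ≤ T
  · have ha : a ≤ T := hab.le.trans hb
    simp [fillAfter, hle, ha, hb, not_lt.2 hb]
  · have hb' := not_le.1 hb
    by_cases ha : a ≤ T
    · have hga := hg.monotone (hle.2 ha)
      simp [fillAfter, hle, ha, hb, hb', min_eq_right hb'.le]
      rw [← ENNReal.ofReal_add (by linarith) (by linarith)]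
      congr 1
      ring
    · have hga := hg.monotone (le_of_lt (not_le.1 (mt hle.1 ha)))
      simp [fillAfter, hle, ha, hb, min_eq_right hb'.le, hga]

/-! ### Pathwise estimates for the costs -/

section Pathwise

variable {lam c M : ℝ} {Φ : ℝ → ℝ} {ξ g : ℝ≥0 → ℝ}

/-- Allowing $\xi$ growth rate $\lambda/2$ leaves half of the discount, enough for integrability in
time and decay at infinity. -/
lemma abs_discountedPrice_le
    (hM : ∀ t : ℝ≥0, |ξ t| ≤ Real.exp (lam / 2 * t) * M)
    {s : ℝ} (hs : 0 ≤ s) : |discountedPrice lam ξ s| ≤ Real.exp (-(lam / 2) * s) * M := by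
  rw [discountedPrice, abs_mul, abs_of_pos (Real.exp_pos _)]
  calc _ ≤ Real.exp (-lam * s) * (Real.exp (lam / 2 * s.toNNReal) * M) := by gcongr; exact hM _
    _ = _ := by
      rw [Real.coe_toNNReal s hs, ← mul_assoc, ← Real.exp_add]
      ring_nf

lemma abs_discountedPrice_le' (hM0 : 0 ≤ M) (hlam : 0 < lam)
    (hM : ∀ t : ℝ≥0, |ξ t| ≤ Real.exp (lam / 2 * t) * M)
    {s : ℝ} (hs : 0 ≤ s) : |discountedPrice lam ξ s| ≤ M := by
  refine (abs_discountedPrice_le hM hs).trans (mul_le_of_le_one_left hM0 ?_)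
  rw [Real.exp_le_one_iff, neg_mul]
  exact neg_nonpos.2 (by positivity)

lemma continuous_discountedPrice (hξ : Continuous ξ) : Continuous (discountedPrice lam ξ) := by
  unfold discountedPrice
  have := hξ.comp continuous_real_toNNReal
  exact (by fun_prop : Continuous fun s => Real.exp (-lam * s)).mul this

lemma integrableOn_discountedPrice (hc : 0 ≤ c) (hM0 : 0 ≤ M) (hlam : 0 < lam)
    (hM : ∀ t : ℝ≥0, |ξ t| ≤ Real.exp (lam / 2 * t) * M) (hξ : Continuous ξ)
    (hg : IsAdmissiblePath c g) :
    IntegrableOn (discountedPrice lam ξ) (Ici 0) (stieltjesMeasure g) := by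
  have hfin := (stieltjesMeasure_univ_le hc hg).trans_lt ENNReal.one_lt_top
  refine Measure.integrableOn_of_bounded (M := M)
    ((measure_mono (subset_univ _)).trans_lt hfin).ne
    (continuous_discountedPrice hξ).aestronglyMeasurable ?_
  filter_upwards [ae_restrict_mem measurableSet_Ici] with s hs
  exact abs_discountedPrice_le' hM0 hlam hM hs

lemma abs_setIntegral_discountedPrice_le (hc : 0 ≤ c) (hM0 : 0 ≤ M) (hlam : 0 < lam)
    (hM : ∀ t : ℝ≥0, |ξ t| ≤ Real.exp (lam / 2 * t) * M) (hg : IsAdmissiblePath c g) :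
    |∫ s in Ici (0 : ℝ), discountedPrice lam ξ s ∂(stieltjesMeasure g)| ≤ M := by
  have hle := (measure_mono (subset_univ (Ici (0 : ℝ)))).trans (stieltjesMeasure_univ_le hc hg)
  have h := norm_setIntegral_le_of_norm_le_const (μ := stieltjesMeasure g) (s := Ici (0 : ℝ))
    (f := discountedPrice lam ξ) (C := M) (hle.trans_lt ENNReal.one_lt_top)
    (fun s hs => abs_discountedPrice_le' hM0 hlam hM hs)
  refine h.trans (mul_le_of_le_one_right hM0 ?_)
  exact ENNReal.toReal_le_of_le_ofReal zero_le_one (by simpa using hle)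

lemma IsAdmissiblePath.cost_mem (hc : 0 ≤ c) (hg : IsAdmissiblePath c g)
    (hanti : AntitoneOn Φ (Icc 0 1)) (hone : Φ 1 = 0) (t : ℝ≥0) :
    0 ≤ Φ (c + g t) ∧ Φ (c + g t) ≤ Φ 0 := by
  have h0 := hg.nonneg t
  have hmem : c + g t ∈ Icc (0 : ℝ) 1 := ⟨by linarith, hg.capacity t⟩
  exact ⟨hone ▸ hanti hmem ⟨zero_le_one, le_rfl⟩ hmem.2,
    hanti ⟨le_rfl, zero_le_one⟩ hmem hmem.1⟩

lemma abs_runningIntegrand_le (hc : 0 ≤ c) (hM0 : 0 ≤ M) (hlam : 0 < lam)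
    (hM : ∀ t : ℝ≥0, |ξ t| ≤ Real.exp (lam / 2 * t) * M) (hg : IsAdmissiblePath c g)
    (hanti : AntitoneOn Φ (Icc 0 1)) (hone : Φ 1 = 0) {s : ℝ} (hs : 0 ≤ s) :
    |runningIntegrand lam Φ c ξ g s| ≤ lam * M * Φ 0 * Real.exp (-(lam / 2) * s) := by
  have h := abs_discountedPrice_le hM hs
  obtain ⟨h0, h1⟩ := hg.cost_mem hc hanti hone s.toNNReal
  have e : runningIntegrand lam Φ c ξ g s =
      lam * discountedPrice lam ξ s * Φ (c + g s.toNNReal) := by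
    unfold runningIntegrand discountedPrice; ring
  rw [e, abs_mul, abs_mul, abs_of_pos hlam, abs_of_nonneg h0]
  calc _ ≤ lam * (Real.exp (-(lam / 2) * s) * M) * Φ 0 := by gcongr
    _ = _ := by ring

lemma measurable_runningIntegrand (hΦ : Continuous Φ) (hξ : Continuous ξ) (hg : Monotone g) :
    Measurable (runningIntegrand lam Φ c ξ g) := by
  unfold runningIntegrand
  have h1 : Measurable fun s : ℝ => ξ s.toNNReal := (hξ.comp continuous_real_toNNReal).measurable
  have h2 : Measurable fun s : ℝ => g s.toNNReal := hg.measurable.comp measurable_real_toNNReal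
  exact ((by fun_prop : Measurable fun s : ℝ => Real.exp (-lam * s) * lam).mul h1).mul
    (hΦ.measurable.comp (h2.const_add c))

lemma integrableOn_runningIntegrand (hc : 0 ≤ c) (hM0 : 0 ≤ M) (hlam : 0 < lam)
    (hM : ∀ t : ℝ≥0, |ξ t| ≤ Real.exp (lam / 2 * t) * M) (hξ : Continuous ξ)
    (hg : IsAdmissiblePath c g) (hΦ : Continuous Φ) (hanti : AntitoneOn Φ (Icc 0 1))
    (hone : Φ 1 = 0) : IntegrableOn (runningIntegrand lam Φ c ξ g) (Ioi 0) := by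
  refine Integrable.mono' ((integrableOn_exp_mul_Ioi (a := -(lam / 2)) (by linarith) 0).const_mul
    (lam * M * Φ 0)) (measurable_runningIntegrand hΦ hξ hg.monotone).aestronglyMeasurable ?_
  filter_upwards [ae_restrict_mem measurableSet_Ioi] with s hs
  exact abs_runningIntegrand_le hc hM0 hlam hM hg hanti hone (le_of_lt hs)

/-- The running part contributes $\int_0^\infty\lambda M\Phi(0)e^{-\lambda s/2}ds=2\Phi(0)M$; the
purchases contribute at most $M$, as $dg$ has mass at most $1$. -/
lemma abs_totalCost_le (hc : 0 ≤ c) (hM0 : 0 ≤ M) (hlam : 0 < lam)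
    (hM : ∀ t : ℝ≥0, |ξ t| ≤ Real.exp (lam / 2 * t) * M)
    (hg : IsAdmissiblePath c g) (hanti : AntitoneOn Φ (Icc 0 1))
    (hone : Φ 1 = 0) : |totalCost lam Φ c ξ g| ≤ (2 * Φ 0 + 1) * M := by
  have h1 : |∫ s in Ioi (0 : ℝ), runningIntegrand lam Φ c ξ g s| ≤ 2 * Φ 0 * M := by
    refine (norm_integral_le_of_norm_le (f := runningIntegrand lam Φ c ξ g)
      (μ := volume.restrict (Ioi 0)) ((integrableOn_exp_mul_Ioi (a := -(lam / 2))
      (by linarith) 0).const_mul (lam * M * Φ 0)) ?_).trans (le_of_eq ?_)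
    · filter_upwards [ae_restrict_mem measurableSet_Ioi] with s hs
      exact abs_runningIntegrand_le hc hM0 hlam hM hg hanti hone (le_of_lt hs)
    · rw [integral_const_mul, integral_exp_mul_Ioi (by linarith)]
      simp
      field_simp
  have h2 := abs_setIntegral_discountedPrice_le hc hM0 hlam hM hg
  refine (abs_add_le _ _).trans ?_
  linarith

/-- Stopping at `T` and buying the remaining capacity costs as much as filling up after `T`. -/
lemma totalCost_fillAfter (hc : 0 ≤ c) (hM0 : 0 ≤ M) (hlam : 0 < lam)
    (hM : ∀ t : ℝ≥0, |ξ t| ≤ Real.exp (lam / 2 * t) * M) (hξ : Continuous ξ)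
    (hg : IsAdmissiblePath c g) (hone : Φ 1 = 0) (T : ℝ≥0) :
    totalCost lam Φ c ξ (fillAfter c g T) = stoppedCost lam Φ c ξ g T := by
  unfold totalCost stoppedCost
  have h1 : ∫ s in Ioi (0 : ℝ), runningIntegrand lam Φ c ξ (fillAfter c g T) s =
      ∫ s in (0 : ℝ)..T, runningIntegrand lam Φ c ξ g s := by
    rw [intervalIntegral.integral_of_le T.coe_nonneg, ← integral_indicator measurableSet_Ioi,
      ← integral_indicator measurableSet_Ioc]
    congr 1
    ext s
    by_cases h0 : 0 < s
    · by_cases hT : s ≤ T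
      · have hT' : s.toNNReal ≤ T := Real.toNNReal_le_iff_le_coe.2 hT
        simp [indicator, h0, hT, hT', runningIntegrand, fillAfter]
      -- After $T$ the filled path sits at capacity $1$, where $\Phi$ vanishes.
      · have hT' : ¬ s.toNNReal ≤ T := mt Real.toNNReal_le_iff_le_coe.1 hT
        simp [indicator, h0, hT, hT', runningIntegrand, fillAfter, hone]
    · simp [indicator, h0]
  have h2 : ∫ s in Ici (0 : ℝ), discountedPrice lam ξ s ∂(stieltjesMeasure (fillAfter c g T)) =
      (∫ s in Ico (0 : ℝ) T, discountedPrice lam ξ s ∂(stieltjesMeasure g)) +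
        Real.exp (-lam * T) * ξ T * (1 - (c + g T)) := by
    have hint := integrableOn_discountedPrice hc hM0 hlam hM hξ hg
    rw [stieltjesMeasure_fillAfter hc hg, Measure.restrict_add,
      Measure.restrict_restrict measurableSet_Ici, Ici_inter_Iio, Measure.restrict_smul,
      restrict_dirac' measurableSet_Ici, if_pos (mem_Ici.2 T.coe_nonneg), integral_add_measure,
      integral_smul_measure, integral_dirac]
    · congr 1
      rw [ENNReal.toReal_ofReal (by linarith [hg.capacity T]), discountedPrice,
        Real.toNNReal_coe, smul_eq_mul]
      ring
    · exact hint.mono_set Ico_subset_Ici_self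
    · exact (integrable_dirac (by simp)).smul_measure ENNReal.ofReal_ne_top
  rw [h1, h2, add_assoc]

lemma tendsto_stoppedCost (hc : 0 ≤ c) (hM0 : 0 ≤ M) (hlam : 0 < lam)
    (hM : ∀ t : ℝ≥0, |ξ t| ≤ Real.exp (lam / 2 * t) * M) (hξ : Continuous ξ)
    (hg : IsAdmissiblePath c g) (hΦ : Continuous Φ) (hanti : AntitoneOn Φ (Icc 0 1))
    (hone : Φ 1 = 0) :
    Tendsto (fun n : ℕ => stoppedCost lam Φ c ξ g n) atTop (𝓝 (totalCost lam Φ c ξ g)) := by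
  unfold totalCost stoppedCost
  -- The added $0$ is the limit of the terminal payment, which is at most $e^{-\lambda n/2}M$ in
  -- absolute value.
  rw [← add_zero ((∫ s in Ioi (0 : ℝ), runningIntegrand lam Φ c ξ g s) +
    ∫ s in Ici (0 : ℝ), discountedPrice lam ξ s ∂(stieltjesMeasure g))]
  refine Tendsto.add (Tendsto.add ?_ ?_) ?_
  · exact intervalIntegral_tendsto_integral_Ioi 0
      (integrableOn_runningIntegrand hc hM0 hlam hM hξ hg hΦ hanti hone)
      tendsto_natCast_atTop_atTop
  · have hU : Ici (0 : ℝ) = ⋃ n : ℕ, Ico (0 : ℝ) n := by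
      ext x
      simp only [mem_Ici, mem_iUnion, mem_Ico, exists_and_left]
      exact ⟨fun h => ⟨h, exists_nat_gt x⟩, fun h => h.1⟩
    have hint := integrableOn_discountedPrice hc hM0 hlam hM hξ hg
    rw [hU] at hint ⊢
    have := tendsto_setIntegral_of_monotone (μ := stieltjesMeasure g)
      (s := fun n : ℕ => Ico (0 : ℝ) n) (fun n => measurableSet_Ico)
      (fun i j hij => Ico_subset_Ico le_rfl (by exact_mod_cast hij)) hint
    simpa using this
  · have hz : Tendsto (fun n : ℕ => Real.exp (-(lam / 2) * n) * M) atTop (𝓝 0) := by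
      have : Tendsto (fun n : ℕ => -(lam / 2) * (n : ℝ)) atTop atBot :=
        tendsto_natCast_atTop_atTop.const_mul_atTop_of_neg (by linarith)
      simpa using (Real.tendsto_exp_atBot.comp this).mul_const M
    refine squeeze_zero_norm (fun n => ?_) hz
    have h := abs_discountedPrice_le hM (s := n) (by positivity)
    have e : discountedPrice lam ξ n = Real.exp (-lam * ((n : ℝ≥0) : ℝ)) * ξ n := by
      simp [discountedPrice]
    rw [e] at h
    have h0 := hg.nonneg n
    have h1 := hg.capacity n
    rw [Real.norm_eq_abs, abs_mul, abs_of_nonneg (by linarith : 0 ≤ 1 - (c + g n))]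
    refine (mul_le_of_le_one_right (abs_nonneg _) (by linarith)).trans h

end Pathwise

/-! ### Measurability of the costs -/

/-- Sampling at $\lfloor tn\rfloor/n\le t$ gives jointly measurable approximations, which converge
because the sample times approach $t$ from the left. -/
lemma measurable_uncurry_of_left_continuous {u : ℝ≥0 → Ω → ℝ} (hu : ∀ t, Measurable (u t))
    (hl : ∀ ω t, ContinuousWithinAt (fun s => u s ω) (Iic t) t) :
    Measurable fun p : Ω × ℝ≥0 => u p.2 p.1 := by
  have happrox : ∀ n : ℕ, Measurable fun p : Ω × ℝ≥0 =>
      u ((⌊(p.2 : ℝ) * n⌋₊ : ℝ≥0) / n) p.1 := by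
    intro n
    have h1 : Measurable fun q : Ω × ℕ => u ((q.2 : ℝ≥0) / n) q.1 :=
      measurable_from_prod_countable_left fun k => hu ((k : ℝ≥0) / n)
    have h2 : Measurable fun p : Ω × ℝ≥0 => (p.1, ⌊(p.2 : ℝ) * n⌋₊) :=
      measurable_fst.prodMk (Nat.measurable_floor.comp (by fun_prop))
    exact h1.comp h2
  refine measurable_of_tendsto_metrizable happrox (tendsto_pi_nhds.2 fun p => ?_)
  obtain ⟨ω, t⟩ := p
  refine (hl ω t).tendsto.comp (tendsto_nhdsWithin_iff.2 ⟨?_, Eventually.of_forall fun n => ?_⟩)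
  · rw [← NNReal.tendsto_coe]
    refine ((tendsto_nat_floor_mul_div_atTop t.coe_nonneg).comp
      tendsto_natCast_atTop_atTop).congr fun k => ?_
    simp
  · rw [mem_Iic, ← NNReal.coe_le_coe]
    push_cast
    -- For $n=0$ the sample time is $0$, since division by zero yields $0$.
    rcases Nat.eq_zero_or_pos n with rfl | hn
    · simp
    · rw [div_le_iff₀ (by exact_mod_cast hn)]
      exact Nat.floor_le (by positivity)

/-- Half-open intervals form a generating π-system on which the measure is an explicit function of
two values of $\nu$. -/
lemma measurable_stieltjesMeasure {c : ℝ} (hc : 0 ≤ c) {ν : ℝ≥0 → Ω → ℝ}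
    (hν : ∀ t, Measurable (ν t)) (hpath : ∀ ω, IsAdmissiblePath c fun t => ν t ω) :
    Measurable fun ω => stieltjesMeasure fun t => ν t ω := by
  have hIco : ∀ a b : ℝ, Measurable fun ω => stieltjesMeasure (fun t => ν t ω) (Ico a b) := by
    intro a b
    simp_rw [fun ω => stieltjesMeasure_Ico (hpath ω).monotone (hpath ω).left_continuous a b]
    exact ((hν _).sub (hν _)).ennreal_ofReal
  have hfin : ∀ ω, IsFiniteMeasure (stieltjesMeasure fun t => ν t ω) := fun ω =>
    ⟨(stieltjesMeasure_univ_le hc (hpath ω)).trans_lt ENNReal.one_lt_top⟩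
  refine Measurable.measure_of_isPiSystem
    (BorelSpace.measurable_eq.trans (borel_eq_generateFrom_Ico ℝ))
    (isPiSystem_Ico (id : ℝ → ℝ) id) ?_ ?_
  · rintro - ⟨a, b, -, rfl⟩
    exact hIco a b
  · simp_rw [measure_univ_eq_iSup_Ico]
    exact Measurable.iSup fun n => hIco _ _

lemma measurable_controlCost {lam c : ℝ} {Φ : ℝ → ℝ} {X ν : ℝ≥0 → Ω → ℝ} (hc : 0 ≤ c)
    (hΦ : Continuous Φ) (hX : ∀ t, Measurable (X t)) (hXc : ∀ ω, Continuous fun t => X t ω)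
    (hν : ∀ t, Measurable (ν t)) (hpath : ∀ ω, IsAdmissiblePath c fun t => ν t ω) :
    Measurable (controlCost lam Φ c X ν) := by
  have hto : Measurable fun p : Ω × ℝ => (p.1, p.2.toNNReal) :=
    measurable_fst.prodMk measurable_snd.real_toNNReal
  have hX2 : Measurable fun p : Ω × ℝ => X p.2.toNNReal p.1 :=
    (measurable_uncurry_of_left_continuous hX
      fun ω t => (hXc ω).continuousWithinAt).comp hto
  have hν2 : Measurable fun p : Ω × ℝ => ν p.2.toNNReal p.1 :=
    (measurable_uncurry_of_left_continuous hν fun ω => (hpath ω).left_continuous).comp hto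
  have hexp : Measurable fun p : Ω × ℝ => Real.exp (-lam * p.2) := by fun_prop
  let κ : Kernel Ω ℝ := ⟨fun ω => stieltjesMeasure fun t => ν t ω,
    measurable_stieltjesMeasure hc hν hpath⟩
  have : IsFiniteKernel κ := ⟨1, ENNReal.one_lt_top, fun ω => stieltjesMeasure_univ_le hc (hpath ω)⟩
  have h1 : Measurable fun ω => ∫ s in Ioi (0 : ℝ),
      runningIntegrand lam Φ c (fun t => X t ω) (fun t => ν t ω) s := by
    have hm : Measurable fun p : Ω × ℝ =>
        runningIntegrand lam Φ c (fun t => X t p.1) (fun t => ν t p.1) p.2 :=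
      ((hexp.mul_const lam).mul hX2).mul (hΦ.measurable.comp (hν2.const_add c))
    exact hm.stronglyMeasurable.integral_prod_right'.measurable
  have h2 : Measurable fun ω => ∫ s in Ici (0 : ℝ),
      discountedPrice lam (fun t => X t ω) s ∂(stieltjesMeasure fun t => ν t ω) := by
    -- The domain of integration goes into the integrand, so that the kernel is integrated over the
    -- whole line.
    have hm : Measurable fun p : Ω × ℝ => (Ici (0 : ℝ)).indicator
        (discountedPrice lam fun t => X t p.1) p.2 :=
      (hexp.mul hX2).indicator (measurable_snd measurableSet_Ici)
    have := (hm.stronglyMeasurable.integral_kernel_prod_right' (κ := κ)).measurable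
    simp only [integral_indicator measurableSet_Ici] at this
    exact this
  exact h1.add h2

/-- By completeness the set of good paths is measurable. Off it, $X$ and $\nu$ are replaced by $0$,
which makes every path regular and changes the cost only on a null set. -/
lemma aemeasurable_controlCost {P : Measure Ω} [P.IsComplete] {lam c : ℝ} {Φ : ℝ → ℝ}
    {X ν : ℝ≥0 → Ω → ℝ} (hc : c ∈ Icc (0 : ℝ) 1) (hΦ : Continuous Φ) (hX : ∀ t, Measurable (X t))
    (hXc : ∀ᵐ ω ∂P, Continuous fun t => X t ω) (hν : ∀ t, Measurable (ν t))
    (hpath : ∀ᵐ ω ∂P, IsAdmissiblePath c fun t => ν t ω) :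
    AEMeasurable (controlCost lam Φ c X ν) P := by
  classical
  set G : Set Ω := {ω | (Continuous fun t => X t ω) ∧ IsAdmissiblePath c fun t => ν t ω}
  have hG : ∀ᵐ ω ∂P, ω ∈ G := by
    filter_upwards [hXc, hpath] with ω h1 h2 using ⟨h1, h2⟩
  have hGm : MeasurableSet G := (Measure.IsComplete.out' Gᶜ hG).of_compl
  refine ⟨controlCost lam Φ c (fun t => G.piecewise (X t) 0) (fun t => G.piecewise (ν t) 0),
    measurable_controlCost hc.1 hΦ (fun t => (hX t).piecewise hGm measurable_zero) (fun ω => ?_)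
      (fun t => (hν t).piecewise hGm measurable_zero) (fun ω => ?_), ?_⟩
  · by_cases hω : ω ∈ G
    · simpa [hω] using hω.1
    · simpa [hω] using continuous_const
  · by_cases hω : ω ∈ G
    · simpa [hω] using hω.2
    · simp only [hω, not_false_eq_true, piecewise_eq_of_notMem, Pi.zero_apply]
      exact ⟨monotone_const, fun t => continuousWithinAt_const, rfl, fun _ => by simpa using hc.2⟩
  · filter_upwards [hG] with ω hω
    simp [controlCost, hω]

/-! ### Comparison of the two problems -/

section Comparison

variable {P : Measure Ω} {𝓕 : Filtration ℝ≥0 mΩ} {lam c : ℝ} {Φ : ℝ → ℝ}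
  {X ν : ℝ≥0 → Ω → ℝ} {τ : Ω → WithTop ℝ≥0} {M : Ω → ℝ}

/-- The control that follows `ν` up to `τ` and then uses up the remaining capacity. -/
noncomputable def fillAfterStopping (c : ℝ) (ν : ℝ≥0 → Ω → ℝ) (τ : Ω → WithTop ℝ≥0) (t : ℝ≥0)
    (ω : Ω) : ℝ :=
  {ω | τ ω < t}.indicator (fun _ => 1 - c) ω + {ω | τ ω < t}ᶜ.indicator (ν t) ω

lemma fillAfterStopping_eq (hτ : τ ω ≠ ⊤) (t : ℝ≥0) :
    fillAfterStopping c ν τ t ω = fillAfter c (fun s => ν s ω) (τ ω).untopA t := by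
  obtain ⟨T, hT⟩ := WithTop.ne_top_iff_exists.1 hτ
  have hA : (τ ω).untopA = T := by rw [← hT]; rfl
  rw [fillAfterStopping, fillAfter, hA]
  by_cases h : T < t
  · have h' : τ ω < t := by rw [← hT]; exact WithTop.coe_lt_coe.2 h
    rw [indicator_of_mem (by exact h'), indicator_of_notMem (by exact not_not.2 h'),
      if_neg (not_le.2 h), add_zero]
  · have h' : ¬ τ ω < t := by rw [← hT]; exact mt WithTop.coe_lt_coe.1 h
    rw [indicator_of_notMem (by exact h'), indicator_of_mem (by exact h'), if_pos (not_lt.1 h),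
      zero_add]

/-- Path properties are inherited from the deterministic construction; adaptedness holds because
$\{\tau<t\}\in\mathcal F_t$. -/
lemma IsAdmissible.fillAfterStopping (hν : IsAdmissible P 𝓕 c ν) (hτ : IsStoppingTime 𝓕 τ)
    (hfin : ∀ᵐ ω ∂P, τ ω ≠ ⊤) : IsAdmissible P 𝓕 c (fillAfterStopping c ν τ) := by
  have hpath : ∀ᵐ ω ∂P, IsAdmissiblePath c fun t => StorageControl.fillAfterStopping c ν τ t ω := by
    filter_upwards [hν.ae_isAdmissiblePath, hfin] with ω h1 h2
    simp_rw [fillAfterStopping_eq h2]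
    exact h1.fillAfter _
  refine ⟨fun t => ?_, hpath.mono fun ω h => h.monotone, hpath.mono fun ω h => h.left_continuous,
    hpath.mono fun ω h => h.zero, hpath.mono fun ω h => h.capacity⟩
  have hm := hτ.measurableSet_lt t
  exact (measurable_const.indicator hm).add ((hν.adapted t).indicator hm.compl)

/-- The random variable `M` dominates `e^{-λ t / 2} |X_t|` for all `t`. -/
def IsPriceBound (P : Measure Ω) (lam : ℝ) (X : ℝ≥0 → Ω → ℝ) (M : Ω → ℝ) : Prop :=
  Integrable M P ∧ (∀ ω, 0 ≤ M ω) ∧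
    ∀ᵐ ω ∂P, ∀ t : ℝ≥0, |X t ω| ≤ Real.exp (lam / 2 * t) * M ω

lemma ae_abs_controlCost_le (hM : IsPriceBound P lam X M) (hc : 0 ≤ c) (hlam : 0 < lam)
    (hanti : AntitoneOn Φ (Icc 0 1)) (hone : Φ 1 = 0) (hν : IsAdmissible P 𝓕 c ν) :
    ∀ᵐ ω ∂P, |controlCost lam Φ c X ν ω| ≤ (2 * Φ 0 + 1) * M ω := by
  filter_upwards [hM.2.2, hν.ae_isAdmissiblePath] with ω h1 h2
  exact abs_totalCost_le hc (hM.2.1 ω) hlam h1 h2 hanti hone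

lemma integrable_controlCost [P.IsComplete] (hM : IsPriceBound P lam X M) (hc : c ∈ Icc (0 : ℝ) 1)
    (hlam : 0 < lam) (hΦ : Continuous Φ) (hanti : AntitoneOn Φ (Icc 0 1)) (hone : Φ 1 = 0)
    (hX : Adapted 𝓕 X) (hXc : ∀ᵐ ω ∂P, Continuous fun t => X t ω) (hν : IsAdmissible P 𝓕 c ν) :
    Integrable (controlCost lam Φ c X ν) P :=
  (hM.1.const_mul (2 * Φ 0 + 1)).mono'
    (aemeasurable_controlCost hc hΦ (fun t => (hX t).mono (𝓕.le t) le_rfl) hXc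
      (fun t => (hν.adapted t).mono (𝓕.le t) le_rfl) hν.ae_isAdmissiblePath).aestronglyMeasurable
    (ae_abs_controlCost_le hM hc.1 hlam hanti hone hν)

/-- Besides comparing values, this transfers measurability and integrability to the stopped cost,
with no separate argument at a random time. -/
lemma discretionaryCost_ae_eq (hM : IsPriceBound P lam X M) (hc : 0 ≤ c)
    (hlam : 0 < lam) (hone : Φ 1 = 0) (hXc : ∀ᵐ ω ∂P, Continuous fun t => X t ω)
    (hν : IsAdmissible P 𝓕 c ν) (hfin : ∀ᵐ ω ∂P, τ ω ≠ ⊤) :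
    discretionaryCost lam Φ c X ν τ =ᵐ[P] controlCost lam Φ c X (fillAfterStopping c ν τ) := by
  filter_upwards [hM.2.2, hν.ae_isAdmissiblePath, hfin, hXc] with ω h1 h2 h3 h4
  unfold controlCost discretionaryCost
  simp_rw [fillAfterStopping_eq h3]
  exact (totalCost_fillAfter hc (hM.2.1 ω) hlam h1 h4 h2 hone _).symm

lemma discretionaryValues_subset (hM : IsPriceBound P lam X M) (hc : 0 ≤ c)
    (hlam : 0 < lam) (hone : Φ 1 = 0) (hXc : ∀ᵐ ω ∂P, Continuous fun t => X t ω) :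
    discretionaryValues P 𝓕 lam Φ c X ⊆ controlValues P 𝓕 lam Φ c X := by
  rintro r ⟨ν, τ, hν, hτ, hfin, rfl⟩
  exact ⟨_, hν.fillAfterStopping hτ hfin,
    integral_congr_ae (discretionaryCost_ae_eq hM hc hlam hone hXc hν hfin)⟩

lemma bddBelow_controlValues (hM : IsPriceBound P lam X M) (hc : 0 ≤ c)
    (hlam : 0 < lam) (hanti : AntitoneOn Φ (Icc 0 1)) (hone : Φ 1 = 0) :
    BddBelow (controlValues P 𝓕 lam Φ c X) := by
  refine ⟨-∫ ω, (2 * Φ 0 + 1) * M ω ∂P, ?_⟩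
  rintro r ⟨ν, hν, rfl⟩
  exact (abs_le.1 (norm_integral_le_of_norm_le (f := controlCost lam Φ c X ν) (hM.1.const_mul _)
    (ae_abs_controlCost_le hM hc hlam hanti hone hν))).1

lemma zero_isAdmissible (hc : c ≤ 1) : IsAdmissible P 𝓕 c fun _ _ => 0 :=
  ⟨fun _ => measurable_const, .of_forall fun _ => monotone_const,
    .of_forall fun _ _ => continuousWithinAt_const, .of_forall fun _ => rfl,
    .of_forall fun _ _ => by simpa using hc⟩

/-- Stopping at late deterministic times approximates never stopping. -/
lemma tendsto_integral_discretionaryCost [P.IsComplete] (hM : IsPriceBound P lam X M)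
    (hc : c ∈ Icc (0 : ℝ) 1)
    (hlam : 0 < lam) (hΦ : Continuous Φ) (hanti : AntitoneOn Φ (Icc 0 1)) (hone : Φ 1 = 0)
    (hX : Adapted 𝓕 X) (hXc : ∀ᵐ ω ∂P, Continuous fun t => X t ω) (hν : IsAdmissible P 𝓕 c ν) :
    Tendsto (fun n : ℕ => ∫ ω, discretionaryCost lam Φ c X ν (fun _ => ((n : ℝ≥0) : WithTop ℝ≥0)) ω ∂P)
      atTop (𝓝 (∫ ω, controlCost lam Φ c X ν ω ∂P)) := by
  have hst : ∀ n : ℕ, IsStoppingTime 𝓕 fun _ => ((n : ℝ≥0) : WithTop ℝ≥0) :=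
    fun n => isStoppingTime_const 𝓕 _
  have hfin : ∀ n : ℕ, ∀ᵐ _ω ∂P, ((n : ℝ≥0) : WithTop ℝ≥0) ≠ ⊤ :=
    fun n => .of_forall fun _ => WithTop.coe_ne_top
  have heq := fun n : ℕ => discretionaryCost_ae_eq (Φ := Φ) hM hc.1 hlam hone hXc hν (hfin n)
  have hadm := fun n : ℕ => hν.fillAfterStopping (hst n) (hfin n)
  refine tendsto_integral_of_dominated_convergence (fun ω => (2 * Φ 0 + 1) * M ω) (fun n => ?_)
    (hM.1.const_mul _) (fun n => ?_) ?_
  · exact ((integrable_controlCost hM hc hlam hΦ hanti hone hX hXc (hadm n)).congr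
      (heq n).symm).aestronglyMeasurable
  · filter_upwards [heq n, ae_abs_controlCost_le hM hc.1 hlam hanti hone (hadm n)] with ω h1 h2
    rw [h1]
    exact h2
  · filter_upwards [hM.2.2, hν.ae_isAdmissiblePath, hXc] with ω h1 h2 h3
    exact tendsto_stoppedCost hc.1 (hM.2.1 ω) hlam h1 h3 h2 hΦ hanti hone

lemma controlValue_eq_discretionaryValue [P.IsComplete] (hM : IsPriceBound P lam X M)
    (hc : c ∈ Icc (0 : ℝ) 1)
    (hlam : 0 < lam) (hΦ : Continuous Φ) (hanti : AntitoneOn Φ (Icc 0 1)) (hone : Φ 1 = 0)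
    (hX : Adapted 𝓕 X) (hXc : ∀ᵐ ω ∂P, Continuous fun t => X t ω) :
    controlValue P 𝓕 lam Φ c X = discretionaryValue P 𝓕 lam Φ c X := by
  have hsub := discretionaryValues_subset (𝓕 := 𝓕) (Φ := Φ) hM hc.1 hlam hone hXc
  have hbdd := bddBelow_controlValues (𝓕 := 𝓕) hM hc.1 hlam hanti hone
  have hmem : ∀ ν, IsAdmissible P 𝓕 c ν → ∀ n : ℕ,
      ∫ ω, discretionaryCost lam Φ c X ν (fun _ => ((n : ℝ≥0) : WithTop ℝ≥0)) ω ∂P ∈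
        discretionaryValues P 𝓕 lam Φ c X := fun ν hν n =>
    ⟨ν, _, hν, isStoppingTime_const 𝓕 _, .of_forall fun _ => WithTop.coe_ne_top, rfl⟩
  -- One inequality is the inclusion of value sets, the other the limit along $\tau=n$; the zero
  -- control supplies the nonemptiness that real infima require.
  refine le_antisymm (csInf_le_csInf hbdd ⟨_, hmem _ (zero_isAdmissible hc.2) 0⟩ hsub)
    (le_csInf ⟨_, _, zero_isAdmissible hc.2, rfl⟩ ?_)
  rintro r ⟨ν, hν, rfl⟩
  exact ge_of_tendsto
    (tendsto_integral_discretionaryCost hM hc hlam hΦ hanti hone hX hXc hν)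
    (.of_forall fun n => csInf_le (hbdd.mono hsub) (hmem ν hν n))

end Comparison

end StorageControl

open StorageControl
theorem mainTheorem5
    {Ω : Type*} {mΩ : MeasurableSpace Ω} (P : Measure Ω) [IsProbabilityMeasure P] [P.IsComplete]
    (B : ℝ≥0 → Ω → ℝ) (hBm : ∀ t, Measurable (B t)) (hB : IsBrownianReal B P)
    (lam θ m σ : ℝ) (hlam : 0 < lam) (hθ : 0 < θ) (hm : 0 < m) (hσ : 0 < σ)
    (Φ : ℝ → ℝ) (hΦ : ContDiff ℝ 2 Φ) (hΦ_anti : AntitoneOn Φ (Icc 0 1))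
    (hΦ_conv : StrictConvexOn ℝ (Icc 0 1) Φ) (hΦ_one : Φ 1 = 0)
    (X : ℝ → ℝ≥0 → Ω → ℝ)
    (hX : ∀ x, IsOrnsteinUhlenbeck P (augmentedFiltration P B hBm) B θ m σ x (X x)) :
    -- For all `x` and all `c ∈ [0, 1]`, all costs are well defined, both infima are finite, and
    -- the two values agree.
    ∀ x : ℝ, ∀ c ∈ Icc (0 : ℝ) 1,
      (∀ ν, IsAdmissible P (augmentedFiltration P B hBm) c ν →
        (∀ᵐ ω ∂P,
          IntegrableOn (runningIntegrand lam Φ c (fun t => X x t ω) (fun t => ν t ω)) (Ioi 0) ∧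
          IntegrableOn (discountedPrice lam (fun t => X x t ω)) (Ici 0)
            (stieltjesMeasure (fun t => ν t ω))) ∧
        Integrable (controlCost lam Φ c (X x) ν) P ∧
        ∀ τ, IsStoppingTime (augmentedFiltration P B hBm) τ → (∀ᵐ ω ∂P, τ ω ≠ ⊤) →
          Integrable (discretionaryCost lam Φ c (X x) ν τ) P) ∧
      BddBelow (controlValues P (augmentedFiltration P B hBm) lam Φ c (X x)) ∧
      BddBelow (discretionaryValues P (augmentedFiltration P B hBm) lam Φ c (X x)) ∧
      controlValue P (augmentedFiltration P B hBm) lam Φ c (X x) =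
        discretionaryValue P (augmentedFiltration P B hBm) lam Φ c (X x) := by
  intro x c hc
  have hXx := hX x
  obtain ⟨M, hM⟩ : ∃ M, IsPriceBound P lam (X x) M :=
    -- The growth rate is chosen as $a=\lambda/2$.
    hXx.exists_integrable_bound hBm hB hθ hm hσ (half_pos hlam)
  have hXc := hXx.continuous_paths
  have hΦc := hΦ.continuous
  have hbdd := bddBelow_controlValues (𝓕 := augmentedFiltration P B hBm) hM hc.1 hlam
    hΦ_anti hΦ_one
  refine ⟨fun ν hν => ⟨?_, ?_, fun τ hτ hfin => ?_⟩, hbdd,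
    hbdd.mono (discretionaryValues_subset hM hc.1 hlam hΦ_one hXc),
    controlValue_eq_discretionaryValue hM hc hlam hΦc hΦ_anti hΦ_one hXx.adapted hXc⟩
  · filter_upwards [hM.2.2, hν.ae_isAdmissiblePath, hXc] with ω h1 h2 h3
    exact ⟨integrableOn_runningIntegrand hc.1 (hM.2.1 ω) hlam h1 h3 h2 hΦc hΦ_anti hΦ_one,
      integrableOn_discountedPrice hc.1 (hM.2.1 ω) hlam h1 h3 h2⟩
  · exact integrable_controlCost hM hc hlam hΦc hΦ_anti hΦ_one hXx.adapted hXc hν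
  · exact (integrable_controlCost hM hc hlam hΦc hΦ_anti hΦ_one hXx.adapted hXc
      (hν.fillAfterStopping hτ hfin)).congr
      (discretionaryCost_ae_eq hM hc.1 hlam hΦ_one hXc hν hfin).symm
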